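/- Let $X$ be a square-integrable real random variable (a generic claim size) with mean $\mu=\mathbb E X>0$, let $\rho>0$ (the safety loading) and let $u\in\mathbb R$ (the initial capital). Put $\delta=\rho\mu/\mathbb E X^2$ and $u_0=u/\mathbb E X^2$. Let $W=(W_t)_{t\ge0}$ be a standard Brownian motion, and let $$R_t=u_0+W_t+\delta t,\qquad t\ge 0,$$ be the Brownian motion with drift $\delta$ started at $u_0$ (the limiting case of the surplus process). Write $\underline R=\inf_{t\ge0}R_t$, and for $v\le u_0$ let $$\kappa(v)=-\mathbb E\left(\underline R\mid \underline R\le v\right)$$ be the average capital needed to recover the company after ruin. Then, for every $v\le u_0$, $\underline R$ is almost surely finite, $P(\underline R\le v)>0$, $\underline R$ is integrable conditionally on $\{\underline R\le v\}$, and $$\kappa(v)=-v+\frac{\mathbb E X^2}{2\rho\mu}.$$ In particular, $\kappa(v)$ does not depend on $u$, as long as $u/\mathbb E X^2\ge v$. -/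

import Mathlib

open MeasureTheory ProbabilityTheory
open scoped NNReal

noncomputable section

/-- The drift `δ = ρ μ / E X²` of the limiting surplus process, where `μ = E X` is the mean of a
generic claim size `X` under the law `Q` and `ρ` is the safety loading. -/
def limitDrift {Ω' : Type*} [MeasurableSpace Ω'] (Q : Measure Ω') (X : Ω' → ℝ) (ρ : ℝ) : ℝ :=
  ρ * (∫ x, X x ∂Q) / ∫ x, X x ^ 2 ∂Q

/-- The starting point `u₀ = u / E X²` of the limiting surplus process with initial capital `u`. -/
def limitStart {Ω' : Type*} [MeasurableSpace Ω'] (Q : Measure Ω') (X : Ω' → ℝ) (u : ℝ) : ℝ :=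
  u / ∫ x, X x ^ 2 ∂Q

/-- The limiting case of the risk process: `R t = u₀ + W t + δ t`, driven by the process `W`. -/
def limitSurplus {Ω' Ω : Type*} [MeasurableSpace Ω'] (Q : Measure Ω') (X : Ω' → ℝ) (ρ u : ℝ)
    (W : ℝ≥0 → Ω → ℝ) : ℝ≥0 → Ω → ℝ :=
  fun t ω => limitStart Q X u + W t ω + limitDrift Q X ρ * (t : ℝ)

/-- The infimum of the surplus process over the infinite time horizon. -/
def surplusInf {Ω : Type*} (R : ℝ≥0 → Ω → ℝ) (ω : Ω) : ℝ :=
  ⨅ t : ℝ≥0, R t ω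

/-- The ruin event at level `v`: the all-time infimum of the surplus is at most `v`. -/
def ruinEvent {Ω : Type*} (R : ℝ≥0 → Ω → ℝ) (v : ℝ) : Set Ω :=
  {ω | surplusInf R ω ≤ v}

/-- The average capital needed to recover the company after ruin,
`κ(v) = - E (inf R | inf R ≤ v)`: minus the mean of the all-time infimum under the conditional
probability given the ruin event. -/
def averageCapital {Ω : Type*} [MeasurableSpace Ω] (P : Measure Ω) (R : ℝ≥0 → Ω → ℝ) (v : ℝ) : ℝ :=
  - ∫ ω, surplusInf R ω ∂(ProbabilityTheory.cond P (ruinEvent R v))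

end

/-! Since `-W` is again a Brownian motion, `u₀ - inf R` is the supremum `M` of a Brownian motion
with drift `-δ`, and `M` is exponential of rate `2δ`. By lack of memory, the mean of `M` given `M ≥
u₀ - v` is `u₀ - v + 1/(2δ)`; subtracting `u₀` cancels it, so `u` disappears.

The law of `M` comes from optional stopping of `exp(2δ(B_t - δt))`, a martingale of mean one, at the
first passage of level `a` on a finite grid. Markov's inequality gives `P(M ≥ a) ≤ exp(-2δa)`
(`measureReal_exists_grid_le`). For the converse (`exp_le_measureReal_of_dyadic_hit`), the stopped
value is about `exp(2δa)` if the level is reached, up to an overshoot that path continuity makes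
small, and has vanishing expectation otherwise as the horizon grows. Dyadic grids exhaust a
countable dense set of times, and continuity extends the supremum to all times. -/

namespace ProbabilityTheory

open Filter Set Real Topology

/-! ### Exponential martingales and optional stopping on a grid. -/

section ExponentialMartingale

variable {Ω : Type*} [MeasurableSpace Ω] {P : Measure Ω} {B : ℝ≥0 → Ω → ℝ}

lemma IsPreBrownianReal.integrable_exp_mul (hB : IsPreBrownianReal B P) (θ : ℝ) (t : ℝ≥0) :
    Integrable (fun ω ↦ exp (θ * B t ω)) P := by
  have h := integrable_exp_mul_gaussianReal (μ := 0) (v := t) θ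
  rw [← (hB.hasLaw_eval t).map_eq] at h
  exact h.comp_aemeasurable (hB.aemeasurable t)

lemma IsPreBrownianReal.integral_exp_mul (hB : IsPreBrownianReal B P) (θ : ℝ) (t : ℝ≥0) :
    ∫ ω, exp (θ * B t ω) ∂P = exp (θ ^ 2 / 2 * t) := by
  have h := mgf_gaussianReal (hB.hasLaw_eval t).map_eq θ
  rw [mgf] at h
  rw [h]
  congr 1
  ring

/-- The value at time `t` of the exponential martingale of parameter `θ` of the process `B`. -/
noncomputable def expMart (B : ℝ≥0 → Ω → ℝ) (θ : ℝ) (t : ℝ≥0) (ω : Ω) : ℝ :=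
  exp (θ * B t ω - θ ^ 2 / 2 * t)

lemma IsPreBrownianReal.integrable_expMart (hB : IsPreBrownianReal B P) (θ : ℝ) (t : ℝ≥0) :
    Integrable (expMart B θ t) P := by
  have h := (hB.integrable_exp_mul θ t).mul_const (exp (-(θ ^ 2 / 2 * t)))
  unfold expMart
  simpa only [← exp_add, ← sub_eq_add_neg] using h

lemma IsPreBrownianReal.integral_expMart (hB : IsPreBrownianReal B P) (θ : ℝ) (t : ℝ≥0) :
    ∫ ω, expMart B θ t ω ∂P = 1 := by
  simp only [expMart, sub_eq_add_neg, exp_add]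
  rw [integral_mul_const, hB.integral_exp_mul, ← exp_add, add_neg_cancel, exp_zero]

/-- The filtration generated by a process along the grid of mesh `h`. -/
noncomputable def gridFiltration (hm : ∀ t, Measurable (B t)) (h : ℝ≥0) :
    Filtration ℕ ‹MeasurableSpace Ω› :=
  Filtration.natural (fun k : ℕ ↦ B (k * h)) fun k ↦ (hm (k * h)).stronglyMeasurable

lemma measurable_gridFiltration (hm : ∀ t, Measurable (B t)) (h : ℝ≥0) (k : ℕ) :
    Measurable[gridFiltration hm h k] (B (k * h)) :=
  ((Filtration.stronglyAdapted_natural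
    fun k : ℕ ↦ (hm (k * h)).stronglyMeasurable) k).measurable

lemma measurable_gridFiltration_expMart (hm : ∀ t, Measurable (B t)) (θ : ℝ) (h : ℝ≥0) (k : ℕ) :
    Measurable[gridFiltration hm h k] (expMart B θ (k * h)) := by
  have := measurable_gridFiltration hm h k
  unfold expMart
  exact ((this.const_mul θ).sub_const _).exp

lemma IsPreBrownianReal.indep_increment_gridFiltration (hB : IsPreBrownianReal B P)
    (hm : ∀ t, Measurable (B t)) (h : ℝ≥0) (k : ℕ) :
    Indep (MeasurableSpace.comap (fun ω ↦ B (k * h + h) ω - B (k * h) ω) inferInstance)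
      (gridFiltration hm h k) P := by
  rw [gridFiltration, Filtration.natural_eq_comap]
  have key : IndepFun (fun ω ↦ B (k * h + h) ω - B (k * h) ω)
      (fun ω (j : Set.Iic k) ↦ B ((j : ℕ) * h) ω) P :=
    (hB.indepFun_shift (k * h)).comp (φ := fun f : ℝ≥0 → ℝ ↦ f h)
      (ψ := fun (g : Set.Iic (k * h) → ℝ) (j : Set.Iic k) ↦ g ⟨(j : ℕ) * h, mul_le_mul_left (Nat.cast_le.2 j.2) h⟩)
      (measurable_pi_apply h) (measurable_pi_lambda _ fun j ↦ measurable_pi_apply _)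
  exact key

/-- One grid step multiplies the value by the exponential of an increment, which has mean one and is
independent of the past, hence of the current value cut off to `s`. -/
lemma IsPreBrownianReal.martingale_expMart [IsFiniteMeasure P] (hB : IsPreBrownianReal B P)
    (hm : ∀ t, Measurable (B t)) (θ : ℝ) (h : ℝ≥0) :
    Martingale (fun k : ℕ ↦ expMart B θ (k * h)) (gridFiltration hm h) P := by
  refine martingale_of_setIntegral_eq_succ
    (fun k ↦ (measurable_gridFiltration_expMart hm θ h k).stronglyMeasurable)
    (fun k ↦ hB.integrable_expMart θ _) fun k s hs ↦ ?_
  have hs' : MeasurableSet s := (gridFiltration hm h).le k s hs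
  rw [← integral_indicator hs', ← integral_indicator hs']
  set Z : Ω → ℝ := s.indicator (expMart B θ (k * h)) with hZ
  set D : Ω → ℝ := fun ω ↦ B (k * h + h) ω - B (k * h) ω with hD
  have hZm : Measurable[gridFiltration hm h k] Z :=
    (measurable_gridFiltration_expMart hm θ h k).indicator hs
  have hind : IndepFun D Z P :=
    indep_of_indep_of_le_right (hB.indep_increment_gridFiltration hm h k) hZm.comap_le
  have hDm : Measurable D := (hm _).sub (hm _)
  have hprod := (hind.comp (φ := fun x ↦ exp (θ * x - θ ^ 2 / 2 * h)) (ψ := id)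
    (by fun_prop) measurable_id).integral_mul_eq_mul_integral
    (by fun_prop) (hZm.mono ((gridFiltration hm h).le k) le_rfl).aestronglyMeasurable
  have hone : ∫ ω, exp (θ * D ω - θ ^ 2 / 2 * h) ∂P = 1 :=
    (hB.shift (k * h)).integral_expMart θ h
  have heq : s.indicator (expMart B θ ((k + 1 : ℕ) * h)) =
      (fun x ↦ exp (θ * x - θ ^ 2 / 2 * h)) ∘ D * id ∘ Z := by
    ext ω
    by_cases hω : ω ∈ s
    · simp only [hω, indicator_of_mem, expMart, Pi.mul_apply, Function.comp_apply, id, hZ, hD,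
        ← exp_add]
      have : ((k + 1 : ℕ) : ℝ≥0) * h = k * h + h := by push_cast; ring
      rw [this]
      congr 1
      push_cast
      ring
    · simp [hω, hZ]
  rw [heq, hprod]
  simp only [Function.comp_def, id]
  rw [hone, one_mul]

lemma expMart_pos {Ω : Type*} (B : ℝ≥0 → Ω → ℝ) (θ : ℝ) (t : ℝ≥0) (ω : Ω) :
    0 < expMart B θ t ω :=
  exp_pos _

lemma IsPreBrownianReal.integrable_expMart_stopped [IsFiniteMeasure P]
    (hB : IsPreBrownianReal B P) (hm : ∀ t, Measurable (B t)) (θ : ℝ) (h : ℝ≥0)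
    {τ : Ω → ℕ} (hτ : IsStoppingTime (gridFiltration hm h) (fun ω ↦ (τ ω : ℕ∞)))
    {N : ℕ} (hN : ∀ ω, τ ω ≤ N) :
    Integrable (fun ω ↦ expMart B θ (τ ω * h) ω) P := by
  have h1 : Integrable (stoppedValue (fun k : ℕ ↦ expMart B θ (k * h)) fun ω ↦ (τ ω : ℕ∞)) P :=
    (hB.martingale_expMart hm θ h).submartingale.integrable_stoppedValue hτ (N := N)
      fun ω ↦ Nat.cast_le.2 (hN ω)
  exact h1

lemma IsPreBrownianReal.integral_expMart_stopped [IsFiniteMeasure P]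
    (hB : IsPreBrownianReal B P) (hm : ∀ t, Measurable (B t)) (θ : ℝ) (h : ℝ≥0)
    {τ : Ω → ℕ} (hτ : IsStoppingTime (gridFiltration hm h) (fun ω ↦ (τ ω : ℕ∞)))
    {N : ℕ} (hN' : ∀ ω, τ ω ≤ N) :
    ∫ ω, expMart B θ (τ ω * h) ω ∂P = 1 := by
  have hN : ∀ ω, (τ ω : ℕ∞) ≤ N := fun ω ↦ Nat.cast_le.2 (hN' ω)
  have hM := hB.martingale_expMart hm θ h
  have hc := isStoppingTime_const (gridFiltration hm h) N
  -- A martingale is both a sub- and a supermartingale, so comparison with the constant time `N`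
  -- gives both inequalities.
  have h1 := hM.submartingale.expected_stoppedValue_mono hτ hc hN (N := N) fun _ ↦ le_rfl
  have h2 : ∫ ω, -stoppedValue (fun k : ℕ ↦ expMart B θ (k * h)) (fun ω ↦ (τ ω : ℕ∞)) ω ∂P ≤
      ∫ ω, -stoppedValue (fun k : ℕ ↦ expMart B θ (k * h)) (fun _ ↦ (N : ℕ∞)) ω ∂P :=
    hM.supermartingale.neg.expected_stoppedValue_mono hτ hc hN (N := N) fun _ ↦ le_rfl
  have h3 : ∫ ω, stoppedValue (fun k : ℕ ↦ expMart B θ (k * h)) (fun _ ↦ (N : ℕ∞)) ω ∂P = 1 :=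
    hB.integral_expMart θ _
  rw [integral_neg, integral_neg, neg_le_neg_iff] at h2
  exact le_antisymm (h1.trans_eq h3) (h3.symm.trans_le h2)

end ExponentialMartingale

/-! ### Level crossing of Brownian motion with negative drift, on dyadic grids. -/

section DriftHitting

variable {Ω : Type*} {B : ℝ≥0 → Ω → ℝ} {δ a : ℝ}

/-- The process `B` with drift `-δ`. -/
def driftDown (B : ℝ≥0 → Ω → ℝ) (δ : ℝ) (t : ℝ≥0) (ω : Ω) : ℝ := B t ω - δ * t

/-- For `θ = 2δ` the compensator `θ²/2 = 2δ²` is exactly `θδ`, so the martingale is a function of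
the drifted path alone. -/
lemma expMart_two_mul (B : ℝ≥0 → Ω → ℝ) (δ : ℝ) (t : ℝ≥0) (ω : Ω) :
    expMart B (2 * δ) t ω = exp (2 * δ * driftDown B δ t ω) := by
  rw [expMart, driftDown]
  ring_nf

/-- The index of the first point of the grid of mesh `h`, up to index `N`, at which `B` with drift
`-δ` reaches the level `a`, or `N` if there is none. -/
noncomputable def gridHit (B : ℝ≥0 → Ω → ℝ) (δ a : ℝ) (h : ℝ≥0) (N : ℕ) : Ω → ℕ :=
  hittingBtwn (fun k : ℕ ↦ driftDown B δ (k * h)) (Ici a) 0 N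

lemma gridHit_le (h : ℝ≥0) (N : ℕ) (ω : Ω) : gridHit B δ a h N ω ≤ N := hittingBtwn_le ω

lemma le_driftDown_gridHit {h : ℝ≥0} {N : ℕ} {ω : Ω}
    (hω : ∃ k ≤ N, a ≤ driftDown B δ (k * h) ω) :
    a ≤ driftDown B δ (gridHit B δ a h N ω * h) ω := by
  obtain ⟨k, hk, hak⟩ := hω
  exact hittingBtwn_mem_set (u := fun k : ℕ ↦ driftDown B δ (k * h)) (s := Ici a)
    ⟨k, ⟨Nat.zero_le k, hk⟩, hak⟩

lemma driftDown_lt_of_lt_gridHit {h : ℝ≥0} {N k : ℕ} {ω : Ω} (hk : k < gridHit B δ a h N ω) :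
    driftDown B δ (k * h) ω < a :=
  not_le.1 (notMem_of_lt_hittingBtwn (u := fun k : ℕ ↦ driftDown B δ (k * h)) (s := Ici a) hk
    (Nat.zero_le k))

variable [MeasurableSpace Ω] {P : Measure Ω}

lemma measurable_driftDown (hm : ∀ t, Measurable (B t)) (δ : ℝ) (t : ℝ≥0) :
    Measurable (driftDown B δ t) :=
  (hm t).sub_const _

lemma isStoppingTime_gridHit (hm : ∀ t, Measurable (B t)) (δ a : ℝ) (h : ℝ≥0) (N : ℕ) :
    IsStoppingTime (gridFiltration hm h) (fun ω ↦ (gridHit B δ a h N ω : ℕ∞)) :=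
  Adapted.isStoppingTime_hittingBtwn (f := gridFiltration hm h)
    (u := fun k : ℕ ↦ driftDown B δ (k * h))
    (fun k ↦ (measurable_gridFiltration hm h k).sub_const _) measurableSet_Ici

lemma IsPreBrownianReal.integral_expMart_gridHit [IsFiniteMeasure P]
    (hB : IsPreBrownianReal B P) (hm : ∀ t, Measurable (B t)) (θ δ a : ℝ) (h : ℝ≥0) (N : ℕ) :
    ∫ ω, expMart B θ (gridHit B δ a h N ω * h) ω ∂P = 1 :=
  hB.integral_expMart_stopped hm θ h (isStoppingTime_gridHit hm δ a h N) (gridHit_le h N)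

lemma IsPreBrownianReal.integrable_expMart_gridHit [IsFiniteMeasure P]
    (hB : IsPreBrownianReal B P) (hm : ∀ t, Measurable (B t)) (θ δ a : ℝ) (h : ℝ≥0) (N : ℕ) :
    Integrable (fun ω ↦ expMart B θ (gridHit B δ a h N ω * h) ω) P :=
  hB.integrable_expMart_stopped hm θ h (isStoppingTime_gridHit hm δ a h N) (gridHit_le h N)

/-- Markov's inequality for the martingale stopped at the first grid passage: if the level is
reached, the stopped value is at least `exp(2δa)`. -/
lemma IsPreBrownianReal.measureReal_exists_grid_le [IsFiniteMeasure P]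
    (hB : IsPreBrownianReal B P) (hm : ∀ t, Measurable (B t)) (hδ : 0 < δ) (a : ℝ)
    (h : ℝ≥0) (N : ℕ) :
    P.real {ω | ∃ k ≤ N, a ≤ driftDown B δ (k * h) ω} ≤ exp (-(2 * δ * a)) := by
  have h1 := mul_meas_ge_le_integral_of_nonneg (μ := P)
    (ae_of_all _ fun ω ↦ (expMart_pos B _ _ ω).le) (hB.integrable_expMart_gridHit hm (2 * δ) δ a h N)
    (exp (2 * δ * a))
  rw [hB.integral_expMart_gridHit hm] at h1
  have h2 : P.real {ω | ∃ k ≤ N, a ≤ driftDown B δ (k * h) ω} ≤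
      P.real {ω | exp (2 * δ * a) ≤ expMart B (2 * δ) (gridHit B δ a h N ω * h) ω} := by
    refine measureReal_mono fun ω hω ↦ ?_
    have := le_driftDown_gridHit hω
    rw [mem_ofPred_eq, expMart_two_mul]
    gcongr
  rw [exp_neg, ← one_div, le_div_iff₀' (exp_pos _)]
  exact (mul_le_mul_of_nonneg_left h2 (exp_pos _).le).trans h1

/-- The mesh of the dyadic grid of level `m`. -/
noncomputable def dyadicMesh (m : ℕ) : ℝ≥0 := (2 ^ m)⁻¹

lemma two_pow_mul_dyadicMesh (m : ℕ) : 2 ^ m * dyadicMesh m = 1 :=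
  mul_inv_cancel₀ (by positivity)

lemma dyadicMesh_eq_two_mul (m : ℕ) : dyadicMesh m = 2 * dyadicMesh (m + 1) := by
  rw [dyadicMesh, dyadicMesh, pow_succ]
  field_simp

/-- The dyadic numbers. -/
noncomputable def dyadic (p : ℕ × ℕ) : ℝ≥0 := p.1 * dyadicMesh p.2

lemma IsPreBrownianReal.measureReal_exists_dyadic_le [IsFiniteMeasure P]
    (hB : IsPreBrownianReal B P) (hm : ∀ t, Measurable (B t)) (hδ : 0 < δ) (a : ℝ) :
    P.real {ω | ∃ p, a ≤ driftDown B δ (dyadic p) ω} ≤ exp (-(2 * δ * a)) := by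
  -- Level `m` has mesh `2⁻ᵐ` and horizon `m`; refining the mesh and extending the horizon together
  -- makes the events increase.
  set E : ℕ → Set Ω := fun m ↦ {ω | ∃ k ≤ m * 2 ^ m, a ≤ driftDown B δ (k * dyadicMesh m) ω}
  have hE : Monotone E := by
    refine monotone_nat_of_le_succ fun m ω ⟨k, hk, hak⟩ ↦ ⟨2 * k, ?_, ?_⟩
    · rw [pow_succ]
      nlinarith [Nat.zero_le (2 ^ m)]
    · rw [dyadicMesh_eq_two_mul] at hak
      convert hak using 2
      push_cast
      ring
  have hU : {ω | ∃ p, a ≤ driftDown B δ (dyadic p) ω} = ⋃ m, E m := by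
    refine Subset.antisymm (fun ω ⟨p, hp⟩ ↦ ?_) (iUnion_subset fun m ω ⟨k, _, hk⟩ ↦ ⟨(k, m), hk⟩)
    -- Raising the level by `p.1` keeps the same time and makes the horizon reach it.
    refine mem_iUnion.2 ⟨p.2 + p.1, p.1 * 2 ^ p.1, ?_, ?_⟩
    · rw [pow_add, add_mul]
      nlinarith [Nat.zero_le (p.2 * (2 ^ p.2 * 2 ^ p.1)), Nat.zero_le (p.1 * 2 ^ p.1),
        Nat.one_le_two_pow (n := p.2)]
    · convert hp using 2
      rw [dyadic, dyadicMesh, dyadicMesh]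
      push_cast
      rw [pow_add]
      field_simp
  rw [hU, measureReal_def, hE.measure_iUnion]
  refine ENNReal.toReal_le_of_le_ofReal (exp_pos _).le (iSup_le fun m ↦ ?_)
  rw [← ofReal_measureReal]
  exact ENNReal.ofReal_le_ofReal (hB.measureReal_exists_grid_le hm hδ a _ _)

/-- Almost every path agrees on the dyadic numbers with a continuous function. -/
def HasDyadicContinuousPaths (B : ℝ≥0 → Ω → ℝ) (P : Measure Ω) : Prop :=
  ∀ᵐ ω ∂P, ∃ f : ℝ≥0 → ℝ, Continuous f ∧ ∀ p, B (dyadic p) ω = f (dyadic p)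

/-- The event that some step of the grid of mesh `h`, up to index `N`, is greater than `ε`. -/
def bigStep (B : ℝ≥0 → Ω → ℝ) (δ : ℝ) (h : ℝ≥0) (N : ℕ) (ε : ℝ) : Set Ω :=
  {ω | ∃ k < N, ε < driftDown B δ ((k + 1 : ℕ) * h) ω - driftDown B δ (k * h) ω}

lemma measurableSet_bigStep (hm : ∀ t, Measurable (B t)) (δ : ℝ) (h : ℝ≥0) (N : ℕ) (ε : ℝ) :
    MeasurableSet (bigStep B δ h N ε) := by
  have : bigStep B δ h N ε = ⋃ k, ⋃ (_ : k < N),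
      {ω | ε < driftDown B δ ((k + 1 : ℕ) * h) ω - driftDown B δ (k * h) ω} := by
    ext ω; simp [bigStep]
  rw [this]
  exact MeasurableSet.iUnion fun k ↦ MeasurableSet.iUnion fun _ ↦ measurableSet_lt
    measurable_const ((measurable_driftDown hm δ _).sub (measurable_driftDown hm δ _))

lemma tendsto_dyadicMesh : Tendsto (fun m ↦ (dyadicMesh m : ℝ)) atTop (𝓝 0) := by
  have := tendsto_pow_atTop_nhds_zero_of_lt_one (r := (2⁻¹ : ℝ)) (by norm_num) (by norm_num)
  simpa [dyadicMesh] using this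

/-- Uniform continuity on `[0, T]` excludes big steps on almost every path once the mesh is fine, so
the indicators tend to zero almost surely. -/
lemma tendsto_measureReal_bigStep [IsFiniteMeasure P] (hm : ∀ t, Measurable (B t))
    (hc : HasDyadicContinuousPaths B P) (δ : ℝ) (T : ℕ) {ε : ℝ} (hε : 0 < ε) :
    Tendsto (fun m ↦ P.real (bigStep B δ (dyadicMesh m) (T * 2 ^ m) ε)) atTop (𝓝 0) := by
  have key : Tendsto (fun m ↦ P (bigStep B δ (dyadicMesh m) (T * 2 ^ m) ε)) atTop (𝓝 (P ∅)) := by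
    refine tendsto_measure_of_ae_tendsto_indicator_of_isFiniteMeasure atTop MeasurableSet.empty
      (fun m ↦ measurableSet_bigStep hm δ _ _ ε) ?_
    filter_upwards [hc] with ω ⟨f, hf, hfB⟩
    have huc : UniformContinuousOn (fun t : ℝ≥0 ↦ f t - δ * t) (Icc 0 T) :=
      isCompact_Icc.uniformContinuousOn_of_continuous (by fun_prop)
    obtain ⟨η, hη, hfη⟩ := Metric.uniformContinuousOn_iff.1 huc ε hε
    filter_upwards [tendsto_dyadicMesh.eventually (gt_mem_nhds hη)] with m hmη
    simp only [mem_empty_iff_false, iff_false]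
    rintro ⟨k, hk, hlt⟩
    have hT (j : ℕ) (hj : j ≤ T * 2 ^ m) : j * dyadicMesh m ∈ Icc (0 : ℝ≥0) T := by
      refine ⟨zero_le, ?_⟩
      calc (j : ℝ≥0) * dyadicMesh m ≤ (T * 2 ^ m : ℕ) * dyadicMesh m := by gcongr
        _ = T := by
          push_cast
          rw [mul_assoc, two_pow_mul_dyadicMesh, mul_one]
    have hd : dist (((k + 1 : ℕ) : ℝ≥0) * dyadicMesh m) (k * dyadicMesh m) < η := by
      rw [NNReal.dist_eq]
      push_cast
      rw [add_mul, add_sub_cancel_left, one_mul, abs_of_nonneg (NNReal.coe_nonneg _)]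
      exact hmη
    have h1 := hfη _ (hT (k + 1) hk) _ (hT k hk.le) hd
    rw [Real.dist_eq] at h1
    have h2 := hfB (k, m)
    have h3 := hfB (k + 1, m)
    simp only [dyadic] at h2 h3
    rw [driftDown, driftDown, h2, h3] at hlt
    exact absurd (hlt.trans_le (le_abs_self _)) (not_lt.2 h1.le)
  rw [measure_empty] at key
  exact (ENNReal.tendsto_toReal ENNReal.zero_ne_top).comp key

end DriftHitting

/-! ### The exponential law of the dyadic supremum. -/

section SupremumLaw

variable {Ω : Type*} {B : ℝ≥0 → Ω → ℝ} {δ a : ℝ}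

lemma expMart_sq_le {T t : ℝ≥0} (ht : t ≤ T) (ω : Ω) :
    expMart B (2 * δ) t ω ^ 2 ≤ exp (4 * δ ^ 2 * T) * expMart B (4 * δ) t ω := by
  rw [expMart, expMart, ← exp_nat_mul, ← exp_add]
  have : (t : ℝ) ≤ T := ht
  gcongr
  push_cast
  nlinarith [sq_nonneg δ, mul_le_mul_of_nonneg_left this (sq_nonneg δ)]

/-- The terms cover, in order: no passage before `T`, where `2δx ≤ δa + δx` for the endpoint `x <
a`; a passage with overshoot at most `ε`; and, for the last two, a big step, where `x ≤ K + x²/K`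
trades the uncontrolled stopped value for a second moment. -/
lemma expMart_gridHit_le (hδ : 0 < δ) (ha : 0 < a) {T : ℝ≥0} {h : ℝ≥0} {N : ℕ} (hN : N * h = T)
    {ε K : ℝ} (hK : 0 < K) {G : Set Ω}
    (hG : ∀ ω, ∀ k : ℕ, a ≤ driftDown B δ (k * h) ω → ω ∈ G) {ω : Ω} (h0 : B 0 ω = 0) :
    expMart B (2 * δ) (gridHit B δ a h N ω * h) ω ≤
      exp (δ * a) * exp (-(δ ^ 2 / 2 * T)) * expMart B δ T ω +
      exp (2 * δ * (a + ε)) * G.indicator 1 ω +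
      K * (bigStep B δ h N ε).indicator 1 ω +
      K⁻¹ * exp (4 * δ ^ 2 * T) * expMart B (4 * δ) (gridHit B δ a h N ω * h) ω := by
  set k := gridHit B δ a h N ω with hk
  have hkN : k ≤ N := gridHit_le h N ω
  have t1 : 0 ≤ exp (δ * a) * exp (-(δ ^ 2 / 2 * T)) * expMart B δ T ω := by
    have := expMart_pos B δ T ω; positivity
  have t2 : 0 ≤ exp (2 * δ * (a + ε)) * G.indicator 1 ω :=
    mul_nonneg (exp_pos _).le (indicator_nonneg (fun _ _ ↦ zero_le_one) _)
  have t3 : 0 ≤ K * (bigStep B δ h N ε).indicator 1 ω :=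
    mul_nonneg hK.le (indicator_nonneg (fun _ _ ↦ zero_le_one) _)
  have t4 : 0 ≤ K⁻¹ * exp (4 * δ ^ 2 * T) * expMart B (4 * δ) (k * h) ω := by
    have := expMart_pos B (4 * δ) (k * h) ω; positivity
  by_cases hA : ω ∈ bigStep B δ h N ε
  · have hkT : k * h ≤ T := by rw [← hN]; gcongr
    have hsq := mul_le_mul_of_nonneg_left (expMart_sq_le (B := B) (δ := δ) hkT ω) (inv_nonneg.2 hK.le)
    rw [← mul_assoc] at hsq
    have hle : expMart B (2 * δ) (k * h) ω ≤ K + K⁻¹ * expMart B (2 * δ) (k * h) ω ^ 2 := by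
      set x := expMart B (2 * δ) (k * h) ω
      rw [← sub_nonneg]
      have : K + K⁻¹ * x ^ 2 - x = K⁻¹ * ((x - K / 2) ^ 2 + 3 / 4 * K ^ 2) := by
        field_simp; ring
      rw [this]
      positivity
    rw [indicator_of_mem hA, Pi.one_apply, mul_one]
    linarith
  by_cases hhit : ∃ j ≤ N, a ≤ driftDown B δ (j * h) ω
  · have hak := le_driftDown_gridHit hhit
    rw [← hk] at hak
    have hle : driftDown B δ (k * h) ω ≤ a + ε := by
      -- The path starts at `0 < a`, so a passage has a preceding grid point, still below `a`.
      rcases Nat.eq_zero_or_eq_succ_pred k with hk0 | hk1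
      · rw [hk0] at hak
        simp [driftDown, h0] at hak
        exact absurd hak (not_le.2 ha)
      · have hlt : k.pred < gridHit B δ a h N ω := by omega
        have h1 := driftDown_lt_of_lt_gridHit hlt
        have h2 : ¬ ε < driftDown B δ ((k.pred + 1 : ℕ) * h) ω - driftDown B δ (k.pred * h) ω :=
          fun hlt' ↦ hA ⟨k.pred, by omega, hlt'⟩
        rw [← Nat.succ_eq_add_one, ← hk1] at h2
        linarith
    have h3 : expMart B (2 * δ) (k * h) ω ≤ exp (2 * δ * (a + ε)) := by
      rw [expMart_two_mul]
      gcongr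
    rw [indicator_of_mem (hG ω k hak), Pi.one_apply, mul_one] at *
    linarith
  · push Not at hhit
    have hkeq : k = N := by
      by_contra hne
      have : a ≤ driftDown B δ (k * h) ω :=
        hittingBtwn_mem_set_of_hittingBtwn_lt (u := fun k : ℕ ↦ driftDown B δ (k * h))
          (s := Ici a) (lt_of_le_of_ne hkN hne)
      exact absurd this (not_le.2 (hhit k hkN))
    have hlt := hhit N le_rfl
    have h3 : expMart B (2 * δ) (k * h) ω ≤
        exp (δ * a) * exp (-(δ ^ 2 / 2 * T)) * expMart B δ T ω := by
      rw [hkeq, expMart_two_mul, hN, expMart, ← exp_add, ← exp_add]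
      rw [hN] at hlt
      gcongr
      have := mul_le_mul_of_nonneg_left hlt.le hδ.le
      unfold driftDown at this ⊢
      linarith
    linarith

variable [MeasurableSpace Ω] {P : Measure Ω} [IsProbabilityMeasure P]

lemma IsPreBrownianReal.one_le_of_gridHit (hB : IsPreBrownianReal B P)
    (hm : ∀ t, Measurable (B t)) (hδ : 0 < δ) (ha : 0 < a) {T h : ℝ≥0} {N : ℕ} (hN : N * h = T)
    {ε K : ℝ} (hK : 0 < K) {G : Set Ω} (hGm : MeasurableSet G)
    (hG : ∀ ω, ∀ k : ℕ, a ≤ driftDown B δ (k * h) ω → ω ∈ G) :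
    1 ≤ exp (δ * a) * exp (-(δ ^ 2 / 2 * T)) + exp (2 * δ * (a + ε)) * P.real G +
      K * P.real (bigStep B δ h N ε) + K⁻¹ * exp (4 * δ ^ 2 * T) := by
  have hAm := measurableSet_bigStep hm δ h N ε
  have i1 := (hB.integrable_expMart δ T).const_mul (exp (δ * a) * exp (-(δ ^ 2 / 2 * T)))
  have i2 : Integrable (fun ω ↦ exp (2 * δ * (a + ε)) * G.indicator (1 : Ω → ℝ) ω) P :=
    ((integrable_const (1 : ℝ)).indicator hGm).const_mul _
  have i3 : Integrable (fun ω ↦ K * (bigStep B δ h N ε).indicator (1 : Ω → ℝ) ω) P :=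
    ((integrable_const (1 : ℝ)).indicator hAm).const_mul _
  have i4 := (hB.integrable_expMart_gridHit hm (4 * δ) δ a h N).const_mul
    (K⁻¹ * exp (4 * δ ^ 2 * T))
  have key := integral_mono_ae (hB.integrable_expMart_gridHit hm (2 * δ) δ a h N)
    (((i1.add i2).add i3).add i4)
    (hB.eval_zero_ae_eq_zero.mono fun ω h0 ↦ expMart_gridHit_le hδ ha hN hK hG h0)
  rw [hB.integral_expMart_gridHit hm] at key
  rw [integral_add' ((i1.add i2).add i3) i4, integral_add' (i1.add i2) i3, integral_add' i1 i2,
    integral_const_mul, integral_const_mul, integral_const_mul, integral_const_mul,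
    hB.integral_expMart, hB.integral_expMart_gridHit hm, integral_indicator_one hGm,
    integral_indicator_one hAm, mul_one, mul_one] at key
  exact key

/-- The order of limits matters: the mesh tends to zero with `K` fixed, then `K → ∞` with `T` fixed,
then `T → ∞`, and finally `ε → 0`. -/
lemma IsPreBrownianReal.exp_le_measureReal_of_dyadic_hit (hB : IsPreBrownianReal B P)
    (hm : ∀ t, Measurable (B t)) (hc : HasDyadicContinuousPaths B P) (hδ : 0 < δ) (ha : 0 < a)
    {G : Set Ω} (hGm : MeasurableSet G)
    (hG : ∀ ω, ∀ p, a ≤ driftDown B δ (dyadic p) ω → ω ∈ G) :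
    exp (-(2 * δ * a)) ≤ P.real G := by
  have h1 (T : ℕ) (ε K : ℝ) (hε : 0 < ε) (hK : 0 < K) :
      1 ≤ exp (δ * a) * exp (-(δ ^ 2 / 2 * T)) + exp (2 * δ * (a + ε)) * P.real G +
        K⁻¹ * exp (4 * δ ^ 2 * T) := by
    have hlim := (((tendsto_measureReal_bigStep hm hc δ T hε).const_mul K).const_add
      (exp (δ * a) * exp (-(δ ^ 2 / 2 * T)) + exp (2 * δ * (a + ε)) * P.real G)).add_const
      (K⁻¹ * exp (4 * δ ^ 2 * T))
    rw [mul_zero, add_zero] at hlim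
    refine ge_of_tendsto' hlim fun m ↦ ?_
    refine hB.one_le_of_gridHit hm hδ ha (T := T) ?_ hK hGm fun ω k hk ↦ hG ω (k, m) hk
    push_cast
    rw [mul_assoc, two_pow_mul_dyadicMesh, mul_one]
  have h2 (T : ℕ) (ε : ℝ) (hε : 0 < ε) :
      1 ≤ exp (δ * a) * exp (-(δ ^ 2 / 2 * T)) + exp (2 * δ * (a + ε)) * P.real G := by
    have hlim := ((tendsto_inv_atTop_zero (𝕜 := ℝ)).mul_const (exp (4 * δ ^ 2 * T))).const_add
      (exp (δ * a) * exp (-(δ ^ 2 / 2 * T)) + exp (2 * δ * (a + ε)) * P.real G)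
    rw [zero_mul, add_zero] at hlim
    exact ge_of_tendsto hlim ((eventually_gt_atTop 0).mono fun K hK ↦ h1 T ε K hε hK)
  have h3 (ε : ℝ) (hε : 0 < ε) : 1 ≤ exp (2 * δ * (a + ε)) * P.real G := by
    have hT : Tendsto (fun T : ℕ ↦ exp (-(δ ^ 2 / 2 * T))) atTop (𝓝 0) :=
      tendsto_exp_neg_atTop_nhds_zero.comp
        (tendsto_natCast_atTop_atTop.const_mul_atTop (by positivity))
    have hlim := (hT.const_mul (exp (δ * a))).add_const (exp (2 * δ * (a + ε)) * P.real G)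
    rw [mul_zero, zero_add] at hlim
    exact ge_of_tendsto' hlim fun T ↦ h2 T ε hε
  have h4 : 1 ≤ exp (2 * δ * a) * P.real G := by
    have hcont : Continuous fun ε : ℝ ↦ exp (2 * δ * (a + ε)) * P.real G := by fun_prop
    have hlim := hcont.continuousWithinAt (s := Ioi 0) (x := 0)
    simp only [ContinuousWithinAt, add_zero] at hlim
    exact ge_of_tendsto hlim (eventually_mem_nhdsWithin.mono fun ε hε ↦ h3 ε hε)
  rw [exp_neg, inv_le_iff_one_le_mul₀' (exp_pos _)]
  exact h4

/-- The supremum over dyadic times of `B` with drift `-δ`. -/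
noncomputable def dyadicSup (B : ℝ≥0 → Ω → ℝ) (δ : ℝ) (ω : Ω) : ℝ :=
  ⨆ p, driftDown B δ (dyadic p) ω

lemma measurable_dyadicSup (hm : ∀ t, Measurable (B t)) (δ : ℝ) : Measurable (dyadicSup B δ) :=
  Measurable.iSup fun _ ↦ measurable_driftDown hm δ _

lemma IsPreBrownianReal.ae_bddAbove_driftDown (hB : IsPreBrownianReal B P)
    (hm : ∀ t, Measurable (B t)) (hδ : 0 < δ) :
    ∀ᵐ ω ∂P, BddAbove (range fun p ↦ driftDown B δ (dyadic p) ω) := by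
  rw [ae_iff, ← measureReal_eq_zero_iff]
  refine le_antisymm ?_ measureReal_nonneg
  have hlim : Tendsto (fun x : ℝ ↦ exp (-(2 * δ * x))) atTop (𝓝 0) :=
    tendsto_exp_neg_atTop_nhds_zero.comp (tendsto_id.const_mul_atTop (by positivity))
  refine ge_of_tendsto' hlim fun x ↦
    (measureReal_mono fun ω hω ↦ ?_).trans (hB.measureReal_exists_dyadic_le hm hδ x)
  obtain ⟨_, ⟨p, rfl⟩, hp⟩ := not_bddAbove_iff.1 hω x
  exact ⟨p, hp.le⟩

lemma IsPreBrownianReal.measureReal_lt_dyadicSup (hB : IsPreBrownianReal B P)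
    (hm : ∀ t, Measurable (B t)) (hc : HasDyadicContinuousPaths B P) (hδ : 0 < δ) (ha : 0 ≤ a) :
    P.real {ω | a < dyadicSup B δ ω} = exp (-(2 * δ * a)) := by
  have hae : {ω | a < dyadicSup B δ ω} =ᵐ[P] {ω | ∃ p, a < driftDown B δ (dyadic p) ω} := by
    filter_upwards [hB.ae_bddAbove_driftDown hm hδ] with ω hω
    exact propext (lt_ciSup_iff hω)
  rw [measureReal_congr hae]
  have hsub : {ω | ∃ p, a < driftDown B δ (dyadic p) ω} ⊆
      {ω | ∃ p, a ≤ driftDown B δ (dyadic p) ω} := fun ω ⟨p, hp⟩ ↦ ⟨p, hp.le⟩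
  refine le_antisymm ((measureReal_mono hsub).trans
    (hB.measureReal_exists_dyadic_le hm hδ a)) ?_
  have hcont : Continuous fun x : ℝ ↦ exp (-(2 * δ * x)) := by fun_prop
  -- Levels `x > a` decreasing to `a` yield the strict inequality and also cover `a = 0`.
  refine le_of_tendsto (hcont.continuousWithinAt (s := Ioi a) (x := a))
    (eventually_mem_nhdsWithin.mono fun x (hx : a < x) ↦ ?_)
  refine hB.exp_le_measureReal_of_dyadic_hit hm hc hδ (ha.trans_lt hx) ?_
    fun ω p hp ↦ ⟨p, hx.trans_le hp⟩
  have : {ω | ∃ p, a < driftDown B δ (dyadic p) ω} = ⋃ p, {ω | a < driftDown B δ (dyadic p) ω} := by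
    ext; simp
  rw [this]
  exact MeasurableSet.iUnion fun p ↦ measurableSet_lt measurable_const (measurable_driftDown hm δ _)

lemma IsPreBrownianReal.ae_nonneg_dyadicSup (hB : IsPreBrownianReal B P)
    (hm : ∀ t, Measurable (B t)) (hδ : 0 < δ) : ∀ᵐ ω ∂P, 0 ≤ dyadicSup B δ ω := by
  filter_upwards [hB.ae_bddAbove_driftDown hm hδ, hB.eval_zero_ae_eq_zero] with ω hω h0
  refine (le_ciSup hω (0, 0)).trans' ?_
  simp [driftDown, dyadic, h0]

lemma IsPreBrownianReal.hasLaw_dyadicSup (hB : IsPreBrownianReal B P)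
    (hm : ∀ t, Measurable (B t)) (hc : HasDyadicContinuousPaths B P) (hδ : 0 < δ) :
    HasLaw (dyadicSup B δ) (expMeasure (2 * δ)) P := by
  have hM := measurable_dyadicSup hm δ
  have hr : 0 < 2 * δ := by positivity
  refine ⟨hM.aemeasurable, ?_⟩
  have := isProbabilityMeasure_expMeasure hr
  have : IsProbabilityMeasure (P.map (dyadicSup B δ)) :=
    Measure.isProbabilityMeasure_map hM.aemeasurable
  refine Measure.eq_of_cdf _ _ (StieltjesFunction.ext fun x ↦ ?_)
  rw [cdf_expMeasure_eq hr, cdf_eq_real, map_measureReal_apply hM measurableSet_Iic]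
  have hcompl : dyadicSup B δ ⁻¹' Iic x = {ω | x < dyadicSup B δ ω}ᶜ := by
    ext; simp
  rw [hcompl, probReal_compl_eq_one_sub (measurableSet_lt measurable_const hM)]
  split_ifs with hx
  · rw [hB.measureReal_lt_dyadicSup hm hc hδ hx]
  · have h1 : {ω | x < dyadicSup B δ ω} =ᵐ[P] univ := by
      filter_upwards [hB.ae_nonneg_dyadicSup hm hδ] with ω hω
      exact propext ⟨fun _ ↦ trivial, fun _ ↦ (not_le.1 hx).trans_le hω⟩
    rw [measureReal_congr h1, probReal_univ, sub_self]

end SupremumLaw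

/-! ### Tail and truncated mean of the exponential law. -/

section Exponential

variable {r a : ℝ}

lemma tendsto_mul_exp_neg_mul_atTop (hr : 0 < r) (b : ℝ) :
    Tendsto (fun x : ℝ ↦ -((x + b) * exp (-(r * x)))) atTop (𝓝 0) := by
  have h1 : Tendsto (fun x : ℝ ↦ r * x) atTop atTop := tendsto_id.const_mul_atTop hr
  have h2 := ((tendsto_pow_mul_exp_neg_atTop_nhds_zero 1).comp h1).const_mul r⁻¹
  have h3 := (tendsto_exp_neg_atTop_nhds_zero.comp h1).const_mul b
  have h4 := (h2.add h3).neg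
  simp only [mul_zero, add_zero, neg_zero] at h4
  refine h4.congr fun x ↦ ?_
  simp only [Function.comp_apply, pow_one]
  field_simp

lemma hasDerivAt_mul_exp_neg_mul (hr : 0 < r) (x : ℝ) :
    HasDerivAt (fun x : ℝ ↦ -((x + r⁻¹) * exp (-(r * x)))) (r * exp (-(r * x)) * x) x := by
  have h1 : HasDerivAt (fun x : ℝ ↦ exp (-(r * x))) (exp (-(r * x)) * -r) x := by
    simpa using (((hasDerivAt_id x).const_mul r).neg).exp
  refine (((hasDerivAt_id x).add_const r⁻¹).mul h1).neg.congr_deriv ?_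
  simp only [id]
  field_simp
  ring

lemma integrableOn_id_exp (hr : 0 < r) (ha : 0 ≤ a) :
    IntegrableOn (fun x : ℝ ↦ r * exp (-(r * x)) * x) (Ioi a) :=
  integrableOn_Ioi_deriv_of_nonneg' (fun x _ ↦ hasDerivAt_mul_exp_neg_mul hr x)
    (fun x (hx : a < x) ↦ by have := ha.trans hx.le; positivity)
    (tendsto_mul_exp_neg_mul_atTop hr _)

lemma integral_id_exp (hr : 0 < r) (ha : 0 ≤ a) :
    ∫ x in Ioi a, r * exp (-(r * x)) * x = (a + r⁻¹) * exp (-(r * a)) := by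
  rw [integral_Ioi_of_hasDerivAt_of_tendsto' (fun x _ ↦ hasDerivAt_mul_exp_neg_mul hr x)
    (integrableOn_id_exp hr ha) (tendsto_mul_exp_neg_mul_atTop hr _)]
  ring

lemma restrict_Ici_expMeasure (r a : ℝ) :
    (expMeasure r).restrict (Ici a) = (volume.restrict (Ioi a)).withDensity (exponentialPDF r) := by
  rw [expMeasure, gammaMeasure, restrict_withDensity measurableSet_Ici,
    Measure.restrict_congr_set Ioi_ae_eq_Ici.symm]
  rfl

lemma measurable_exponentialPDF (r : ℝ) : Measurable (exponentialPDF r) :=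
  (measurable_exponentialPDFReal r).ennreal_ofReal

lemma toReal_exponentialPDF_of_nonneg (hr : 0 < r) {x : ℝ} (hx : 0 ≤ x) :
    (exponentialPDF r x).toReal = r * exp (-(r * x)) := by
  rw [exponentialPDF_of_nonneg hx, ENNReal.toReal_ofReal (by positivity)]

lemma integrableOn_id_expMeasure (hr : 0 < r) (ha : 0 ≤ a) :
    IntegrableOn id (Ici a) (expMeasure r) := by
  rw [IntegrableOn, restrict_Ici_expMeasure, integrable_withDensity_iff
    (measurable_exponentialPDF r) (ae_of_all _ fun _ ↦ ENNReal.ofReal_lt_top)]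
  refine (integrableOn_id_exp hr ha).congr_fun (fun x (hx : a < x) ↦ ?_) measurableSet_Ioi
  simp only [id]
  rw [toReal_exponentialPDF_of_nonneg hr (ha.trans hx.le), mul_comm x]

lemma setIntegral_id_expMeasure (hr : 0 < r) (ha : 0 ≤ a) :
    ∫ x in Ici a, x ∂(expMeasure r) = (a + r⁻¹) * exp (-(r * a)) := by
  rw [restrict_Ici_expMeasure, integral_withDensity_eq_integral_toReal_smul
    (measurable_exponentialPDF r) (ae_of_all _ fun _ ↦ ENNReal.ofReal_lt_top),
    ← integral_id_exp hr ha]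
  refine setIntegral_congr_fun measurableSet_Ioi fun x (hx : a < x) ↦ ?_
  simp only [smul_eq_mul]
  rw [toReal_exponentialPDF_of_nonneg hr (ha.trans hx.le)]

lemma measureReal_Ici_expMeasure (hr : 0 < r) (ha : 0 ≤ a) :
    (expMeasure r).real (Ici a) = exp (-(r * a)) := by
  have := isProbabilityMeasure_expMeasure hr
  have hatom : Ici a =ᵐ[expMeasure r] Ioi a :=
    (withDensity_absolutelyContinuous volume (gammaPDF 1 r)).ae_le Ioi_ae_eq_Ici.symm
  rw [measureReal_congr hatom, ← compl_Iic, probReal_compl_eq_one_sub measurableSet_Iic,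
    ← cdf_eq_real, cdf_expMeasure_eq hr, if_pos ha, sub_sub_cancel]

variable {Ω : Type*} [MeasurableSpace Ω] {P : Measure Ω} {M : Ω → ℝ}

lemma HasLaw.measureReal_Ici_of_expMeasure (hM : HasLaw M (expMeasure r) P) (hr : 0 < r)
    (ha : 0 ≤ a) : P.real {ω | a ≤ M ω} = exp (-(r * a)) := by
  rw [← measureReal_Ici_expMeasure hr ha]
  exact hM.measureReal_eq measurableSet_Ici

lemma HasLaw.integrableOn_of_expMeasure (hM : HasLaw M (expMeasure r) P) (hr : 0 < r)
    (ha : 0 ≤ a) : IntegrableOn M {ω | a ≤ M ω} P := by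
  have h := integrableOn_id_expMeasure hr ha
  rw [← hM.map_eq, IntegrableOn,
    Measure.restrict_map_of_aemeasurable hM.aemeasurable measurableSet_Ici] at h
  exact h.comp_aemeasurable hM.aemeasurable.restrict

lemma HasLaw.setIntegral_of_expMeasure (hM : HasLaw M (expMeasure r) P) (hr : 0 < r)
    (ha : 0 ≤ a) : ∫ ω in {ω | a ≤ M ω}, M ω ∂P = (a + r⁻¹) * exp (-(r * a)) := by
  rw [← setIntegral_id_expMeasure hr ha, ← hM.map_eq,
    setIntegral_map measurableSet_Ici (f := fun x : ℝ ↦ x) aestronglyMeasurable_id hM.aemeasurable]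
  rfl

end Exponential

/-! ### From dyadic times to all times. -/

section RunningSupremum

variable {Ω : Type*} [MeasurableSpace Ω] {P : Measure Ω} {W : ℝ≥0 → Ω → ℝ} {δ : ℝ}

lemma denseRange_dyadic : DenseRange dyadic := by
  intro t
  have h1 := (tendsto_nat_floor_mul_div_atTop (R := ℝ) t.2).comp
    (tendsto_pow_atTop_atTop_of_one_lt (one_lt_two (α := ℝ)))
  have h3 : Tendsto (fun m : ℕ ↦ dyadic (⌊(t : ℝ) * 2 ^ m⌋₊, m)) atTop (𝓝 t) := by
    rw [← NNReal.tendsto_coe]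
    refine h1.congr fun m ↦ ?_
    simp [dyadic, dyadicMesh, div_eq_mul_inv]
  exact mem_closure_of_tendsto h3 (Eventually.of_forall fun m ↦ mem_range_self _)

lemma le_of_forall_denseRange_le {ι X : Type*} [TopologicalSpace X] {f : X → ℝ}
    (hf : Continuous f) {d : ι → X} (hd : DenseRange d) {c : ℝ} (hc : ∀ i, f (d i) ≤ c) (x : X) :
    f x ≤ c :=
  hd.induction_on (p := fun x ↦ f x ≤ c) x (isClosed_le hf continuous_const) hc

lemma IsBrownianReal.ae_bddAbove_and_hasLaw_iSup [IsProbabilityMeasure P]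
    (hW : IsBrownianReal W P) (hδ : 0 < δ) :
    (∀ᵐ ω ∂P, BddAbove (range fun t ↦ driftDown W δ t ω)) ∧
      HasLaw (fun ω ↦ ⨆ t, driftDown W δ t ω) (expMeasure (2 * δ)) P := by
  -- The grid filtration needs measurable coordinates. This modification agrees with `W`
  -- simultaneously only at countably many times, so continuity is transferred on the dyadics alone.
  set B : ℝ≥0 → Ω → ℝ := fun t ↦ (hW.aemeasurable t).mk (W t) with hBdef
  have hWB (t : ℝ≥0) : W t =ᵐ[P] B t := (hW.aemeasurable t).ae_eq_mk
  have hm (t : ℝ≥0) : Measurable (B t) := (hW.aemeasurable t).measurable_mk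
  have hB : IsPreBrownianReal B P := hW.toIsPreBrownianReal.congr hWB
  have hdy : ∀ᵐ ω ∂P, ∀ p, W (dyadic p) ω = B (dyadic p) ω := ae_all_iff.2 fun p ↦ hWB _
  have hc : HasDyadicContinuousPaths B P := by
    filter_upwards [hW.cont, hdy] with ω hω hωp using ⟨_, hω, fun p ↦ (hωp p).symm⟩
  have hcont : ∀ᵐ ω ∂P, Continuous fun t ↦ driftDown W δ t ω := by
    filter_upwards [hW.cont] with ω hω
    unfold driftDown
    fun_prop
  have hle : ∀ᵐ ω ∂P, ∀ t, driftDown W δ t ω ≤ dyadicSup B δ ω := by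
    filter_upwards [hcont, hdy, hB.ae_bddAbove_driftDown hm hδ] with ω hω hωp hbdd
    refine le_of_forall_denseRange_le hω denseRange_dyadic fun p ↦ ?_
    rw [driftDown, hωp p]
    exact le_ciSup hbdd p
  refine ⟨hle.mono fun ω hω ↦ ⟨_, forall_mem_range.2 hω⟩, (hB.hasLaw_dyadicSup hm hc hδ).congr ?_⟩
  filter_upwards [hle, hdy] with ω hω hωp
  refine le_antisymm (ciSup_le hω) (ciSup_le fun p ↦ ?_)
  rw [driftDown, ← hωp p]
  exact le_ciSup (f := fun t ↦ driftDown W δ t ω) ⟨_, forall_mem_range.2 hω⟩ (dyadic p)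

end RunningSupremum

end ProbabilityTheory

/-! ### The infimum of the surplus and the conditional mean. -/

section Surplus

open Filter Set Real Topology

variable {Ω Ω' : Type*} [MeasurableSpace Ω'] {Q : Measure Ω'} {X : Ω' → ℝ}

lemma limitSurplus_eq_sub (Q : Measure Ω') (X : Ω' → ℝ) (ρ u : ℝ) (W : ℝ≥0 → Ω → ℝ) (t : ℝ≥0)
    (ω : Ω) : limitSurplus Q X ρ u W t ω =
      limitStart Q X u - driftDown (-W) (limitDrift Q X ρ) t ω := by
  simp only [limitSurplus, driftDown, Pi.neg_apply]
  ring

/-- Boundedness is needed because real suprema and infima of unbounded families default to `0`. -/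
lemma surplusInf_limitSurplus (Q : Measure Ω') (X : Ω' → ℝ) (ρ u : ℝ) (W : ℝ≥0 → Ω → ℝ) {ω : Ω}
    (h : BddAbove (range fun t ↦ driftDown (-W) (limitDrift Q X ρ) t ω)) :
    surplusInf (limitSurplus Q X ρ u W) ω =
      limitStart Q X u - ⨆ t, driftDown (-W) (limitDrift Q X ρ) t ω := by
  simp only [surplusInf, limitSurplus_eq_sub]
  refine le_antisymm ?_ (le_ciInf fun t ↦ sub_le_sub_left (le_ciSup h t) _)
  rw [le_sub_comm]
  refine ciSup_le fun t ↦ ?_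
  rw [le_sub_comm]
  refine ciInf_le (f := fun t ↦ limitStart Q X u - driftDown (-W) (limitDrift Q X ρ) t ω) ?_ t
  obtain ⟨c, hc⟩ := h
  exact ⟨limitStart Q X u - c,
    forall_mem_range.2 fun t ↦ sub_le_sub_left (hc (mem_range_self t)) _⟩

variable [MeasurableSpace Ω] {P : Measure Ω} [IsProbabilityMeasure P] {W : ℝ≥0 → Ω → ℝ}
  {ρ u v : ℝ}

/-- The average capital after ruin of a surplus process with positive drift `δ` is
`-v + 1 / (2 * δ)`. -/
lemma surplus_of_limitDrift_pos (hW : IsBrownianReal W P) (hδ : 0 < limitDrift Q X ρ)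
    (hv : v ≤ limitStart Q X u) :
    (∀ᵐ ω ∂P, BddBelow (Set.range fun t => limitSurplus Q X ρ u W t ω)) ∧
      0 < P (ruinEvent (limitSurplus Q X ρ u W) v) ∧
      Integrable (surplusInf (limitSurplus Q X ρ u W))
        (ProbabilityTheory.cond P (ruinEvent (limitSurplus Q X ρ u W) v)) ∧
      averageCapital P (limitSurplus Q X ρ u W) v = -v + (2 * limitDrift Q X ρ)⁻¹ := by
  set δ := limitDrift Q X ρ with hδdef
  set u₀ := limitStart Q X u with hu₀
  obtain ⟨hbdd, hlaw⟩ := hW.neg.ae_bddAbove_and_hasLaw_iSup hδ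
  set M : Ω → ℝ := fun ω ↦ ⨆ t, driftDown (-W) δ t ω with hM
  have hr : 0 < 2 * δ := by positivity
  have ha : 0 ≤ u₀ - v := sub_nonneg.2 hv
  have hinf : surplusInf (limitSurplus Q X ρ u W) =ᵐ[P] fun ω ↦ u₀ - M ω :=
    hbdd.mono fun ω hω ↦ surplusInf_limitSurplus Q X ρ u W hω
  have hset : ruinEvent (limitSurplus Q X ρ u W) v =ᵐ[P] {ω | u₀ - v ≤ M ω} := by
    filter_upwards [hinf] with ω hω
    refine propext ?_
    change surplusInf (limitSurplus Q X ρ u W) ω ≤ v ↔ u₀ - v ≤ M ω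
    rw [hω, sub_le_comm]
  have hprob := hlaw.measureReal_Ici_of_expMeasure hr ha
  have hcond : ProbabilityTheory.cond P (ruinEvent (limitSurplus Q X ρ u W) v) =
      (P {ω | u₀ - v ≤ M ω})⁻¹ • P.restrict {ω | u₀ - v ≤ M ω} := by
    rw [ProbabilityTheory.cond, measure_congr hset, Measure.restrict_congr_set hset]
  have hpos : 0 < P {ω | u₀ - v ≤ M ω} := by
    rw [pos_iff_ne_zero]
    intro h0
    rw [measureReal_def, h0] at hprob
    exact absurd hprob (exp_pos _).ne
  have hint := hlaw.integrableOn_of_expMeasure hr ha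
  have hint' : Integrable (fun ω ↦ u₀ - M ω) (P.restrict {ω | u₀ - v ≤ M ω}) :=
    (integrable_const u₀).sub hint
  refine ⟨hbdd.mono fun ω ⟨c, hc⟩ ↦ ⟨u₀ - c, forall_mem_range.2 fun t ↦ ?_⟩, ?_, ?_, ?_⟩
  · rw [limitSurplus_eq_sub]
    exact sub_le_sub_left (hc (mem_range_self t)) _
  · rwa [measure_congr hset]
  · rw [hcond]
    exact (hint'.congr (EventuallyEq.symm (ae_restrict_of_ae hinf))).smul_measure (ENNReal.inv_ne_top.2 hpos.ne')
  · rw [averageCapital, hcond, integral_smul_measure,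
      integral_congr_ae (ae_restrict_of_ae hinf), integral_sub (integrable_const u₀) hint,
      hlaw.setIntegral_of_expMeasure hr ha, setIntegral_const, hprob, ENNReal.toReal_inv,
      ← measureReal_def, hprob]
    -- The factor `exp(-2δ(u₀ - v))` is common to the truncated mean and the ruin probability and
    -- cancels: this is lack of memory.
    have := (exp_pos (-(2 * δ * (u₀ - v)))).ne'
    simp only [smul_eq_mul]
    field_simp
    ring

end Surplus

theorem theorem8
    {Ω : Type*} [MeasurableSpace Ω] (P : Measure Ω) [IsProbabilityMeasure P]
    (W : ℝ≥0 → Ω → ℝ) (hW : IsBrownianReal W P)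
    {Ω' : Type*} [MeasurableSpace Ω'] (Q : Measure Ω') [IsProbabilityMeasure Q]
    (X : Ω' → ℝ) (hX : MemLp X 2 Q) (hμ : 0 < ∫ x, X x ∂Q)
    (ρ : ℝ) (hρ : 0 < ρ) (v : ℝ) :
    (∀ u : ℝ, v ≤ limitStart Q X u →
      -- the conditional expectation is meaningful: the all-time infimum is a.s. finite, the
      -- event conditioned on has positive probability, and the infimum is integrable given it
      (∀ᵐ ω ∂P, BddBelow (Set.range fun t => limitSurplus Q X ρ u W t ω)) ∧
      0 < P (ruinEvent (limitSurplus Q X ρ u W) v) ∧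
      Integrable (surplusInf (limitSurplus Q X ρ u W))
        (ProbabilityTheory.cond P (ruinEvent (limitSurplus Q X ρ u W) v)) ∧
      averageCapital P (limitSurplus Q X ρ u W) v
        = -v + (∫ x, X x ^ 2 ∂Q) / (2 * ρ * ∫ x, X x ∂Q)) ∧
    (∀ u₁ u₂ : ℝ, v ≤ limitStart Q X u₁ → v ≤ limitStart Q X u₂ →
      averageCapital P (limitSurplus Q X ρ u₁ W) v
        = averageCapital P (limitSurplus Q X ρ u₂ W) v) := by
  have hsq : Integrable (fun x ↦ X x ^ 2) Q := hX.integrable_sq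
  have hsq_pos : 0 < ∫ x, X x ^ 2 ∂Q := by
    -- A vanishing second moment would force `X = 0` almost surely, against the positive mean.
    refine (integral_nonneg fun x ↦ sq_nonneg (X x)).lt_of_ne' fun h0 ↦ ?_
    have h1 := (integral_eq_zero_iff_of_nonneg (fun x ↦ sq_nonneg (X x)) hsq).1 h0
    have h2 : X =ᵐ[Q] 0 := h1.mono fun x hx ↦ pow_eq_zero_iff two_ne_zero |>.1 hx
    rw [integral_congr_ae h2] at hμ
    simp at hμ
  have hδ : 0 < limitDrift Q X ρ := div_pos (mul_pos hρ hμ) hsq_pos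
  have hval : (2 * limitDrift Q X ρ)⁻¹ = (∫ x, X x ^ 2 ∂Q) / (2 * ρ * ∫ x, X x ∂Q) := by
    rw [limitDrift]
    field_simp
  have key (u : ℝ) (hu : v ≤ limitStart Q X u) := surplus_of_limitDrift_pos hW hδ hu
  refine ⟨fun u hu ↦ ?_, fun u₁ u₂ h₁ h₂ ↦ ?_⟩
  · rw [← hval]
    exact key u hu
  · rw [(key u₁ h₁).2.2.2, (key u₂ h₂).2.2.2]
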